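/- Let $\mathcal X$ be a finite non-empty set and let $W$ be an irreducible and ergodic (i.e. aperiodic) transition matrix on $\mathcal X$, where $W(x|\bar x)$ is the probability of moving from $\bar x$ to $x$, so $\sum_x W(x|\bar x)=1$ for every $\bar x$. Let $g:\mathcal X\times\mathcal X\to\mathbb R$ be any function. For $\theta\in\mathbb R$ let $\phi(\theta)=\log\lambda_\theta$, where $\lambda_\theta$ is the Perron–Frobenius eigenvalue (spectral radius) of the matrix with entries $W(x|\bar x)e^{\theta g(x,\bar x)}$. Then $W$ has exactly one stationary distribution $\tilde P_0$ (that is, $\tilde P_0\ge 0$, $\sum_x\tilde P_0(x)=1$, $\sum_{\bar x}W(x|\bar x)\tilde P_0(\bar x)=\tilde P_0(x)$); the function $\phi$ is twice continuously differentiable in a neighbourhood of $0$; with $A_{x,\bar x}:=\tilde P_0(x)$ and $W_{x,\bar x}:=W(x|\bar x)$, the matrix $I-(W-A)$ is invertible; and, with the fundamental matrix $Z:=(I-(W-A))^{-1}$, $$\frac{d^2\phi}{d\theta^2}(0)=\mathsf V_0[g(X,X')]+2\sum_{x,\bar x\in\mathcal X}\Bigl(\sum_{x_o}g(x_o,x)\,W(x_o|x)\Bigr)\,(Z-A)_{x,\bar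 x}\,\Bigl(\sum_{\bar x_o}g(\bar x,\bar x_o)\,\tilde P_0(\bar x_o)\,W(\bar x|\bar x_o)\Bigr),$$ where $\mathsf V_0[g(X,X')]$ is the variance of $g(X,X')$ when $(X,X')$ has the joint distribution $\Pr\{X=x,X'=\bar x\}=W(x|\bar x)\tilde P_0(\bar x)$. -/

import Mathlib

open scoped Matrix

/-! Throughout, a transition matrix `W` on a finite set `X` is column-stochastic:
`W x y` is the probability `W(x|y)` of moving from `y` to `x`. -/

namespace MarkovAsymptoticVariance

variable {X : Type*} [Fintype X] [DecidableEq X]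

/-- Aperiodicity: no state `x` admits an integer `d ≥ 2` such that `(W ^ n) x x = 0`
unless `d` divides `n`. -/
def IsAperiodic (W : Matrix X X ℝ) : Prop :=
  ∀ x : X, ∀ d : ℕ, 2 ≤ d → ∃ n : ℕ, 0 < (W ^ n) x x ∧ ¬ d ∣ n

/-- An irreducible and ergodic transition matrix on `X`. -/
structure IsErgodicTransition (W : Matrix X X ℝ) : Prop where
  stochastic : W ∈ Matrix.colStochastic ℝ X
  irreducible : W.IsIrreducible
  aperiodic : IsAperiodic W

/-- `P` is a stationary distribution of `W`: a Perron-Frobenius eigenvector of `W`,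
normalized to be a probability distribution. -/
structure IsStationaryDistribution (W : Matrix X X ℝ) (P : X → ℝ) : Prop where
  nonneg : ∀ x, 0 ≤ P x
  sum_eq_one : ∑ x, P x = 1
  stationary : W *ᵥ P = P

/-- The Perron-Frobenius eigenvalue of an entrywise nonnegative matrix: its spectral radius,
that is, the largest modulus of its complex eigenvalues. -/
noncomputable def perronFrobeniusEigenvalue (M : Matrix X X ℝ) : ℝ :=
  (spectralRadius ℂ (M.map (fun r : ℝ => (r : ℂ)))).toReal

/-- The tilted matrix `W(x|y) e^{θ g(x,y)}`. -/
noncomputable def tilted (W : Matrix X X ℝ) (g : X → X → ℝ) (θ : ℝ) : Matrix X X ℝ :=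
  Matrix.of fun x y => W x y * Real.exp (θ * g x y)

/-- The potential function `φ(θ)`, the logarithm of the Perron-Frobenius eigenvalue of the
tilted matrix. -/
noncomputable def potential (W : Matrix X X ℝ) (g : X → X → ℝ) (θ : ℝ) : ℝ :=
  Real.log (perronFrobeniusEigenvalue (tilted W g θ))

/-- The expectation of `f(X, X')` when `X'` has law `P` and `X` given `X' = y` has law
`W(·|y)`, i.e. under the joint distribution `(W × P)(x, y) = W(x|y) P(y)`. -/
def jointExpectation (W : Matrix X X ℝ) (P : X → ℝ) (f : X → X → ℝ) : ℝ :=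
  ∑ x, ∑ y, W x y * P y * f x y

/-- The variance of `g(X, X')` under the joint distribution `W × P`. -/
def jointVariance (W : Matrix X X ℝ) (P : X → ℝ) (g : X → X → ℝ) : ℝ :=
  jointExpectation W P fun x y => (g x y - jointExpectation W P g) ^ 2

/-- The stationary projector `A`, with `A x y = P x`. -/
def stationaryProjector (P : X → ℝ) : Matrix X X ℝ :=
  Matrix.of fun x _ => P x

/-- The fundamental matrix `Z = (I - (W - A))⁻¹`. -/
noncomputable def fundamentalMatrix (W : Matrix X X ℝ) (P : X → ℝ) : Matrix X X ℝ :=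
  (1 - (W - stationaryProjector P))⁻¹

end MarkovAsymptoticVariance

/-!
Everything follows from a `C²` branch `v θ` of positive eigenvectors of the tilted matrices
`M_θ = (W x y * exp (θ * g x y))` through the stationary distribution `P = v 0`.

Irreducibility makes every nonzero nonnegative fixed vector of `W` entrywise positive
(`pos_of_fixed`). Applied to `|v|` and `|v| + v`, this shows that `W` has no nonzero fixed vector
of total zero (`eq_zero_of_fixed`), which yields both the uniqueness of `P` and the invertibility
of `I - (W - A)` (`isUnit_one_sub`).

The eigenvector equation is written without the eigenvalue as an unknown:
`M_θ v - (1ᵀ M_θ v) v = 0`, where `1ᵀ v` is the sum of the entries of `v`. Its partial derivative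
in `v` at `(0, P)` is exactly `-(I - (W - A))`, so the implicit function theorem provides the branch
`v θ` (`exists_eigenvector_branch`), automatically with `1ᵀ (v θ) = 1`. By continuity
`v θ` is positive for small `θ`, and a nonnegative matrix with a positive eigenvector has the
corresponding eigenvalue as its spectral radius (`perronFrobeniusEigenvalue_eq`). Hence
`φ θ = log (1ᵀ M_θ v θ)` near `0`.

It remains to differentiate twice (`deriv_eigenvalue_branch`). Let `B`, `C` have entries
`W x y * g x y` and `W x y * g x y ^ 2`. As `1ᵀ v' = 1ᵀ v'' = 0` and `1ᵀ W = 1ᵀ`, one gets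
`λ'(0) = 1ᵀ B P` and `λ''(0) = 1ᵀ C P + 2 1ᵀ B v'(0)`, while the differentiated eigenvector equation
`(I - W) v'(0) = B P - λ'(0) P` is solved by `v'(0) = (Z - A) B P`. Finally
`φ''(0) = λ''(0) - λ'(0) ^ 2`, because `λ(0) = 1`.
-/

open scoped Topology

namespace MarkovAsymptoticVariance

/-! ### The tilted matrix, its eigenvector equation, and the stationary projector -/

variable {X : Type*}

@[simp] lemma tilted_zero (W : Matrix X X ℝ) (g : X → X → ℝ) : tilted W g 0 = W := by
  ext x y
  simp [tilted]

lemma hasDerivAt_tilted_apply (W : Matrix X X ℝ) (g : X → X → ℝ) (x y : X) (t : ℝ) :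
    HasDerivAt (fun t => tilted W g t x y) (tilted W g t x y * g x y) t := by
  simp only [tilted, Matrix.of_apply, mul_assoc]
  exact ((((hasDerivAt_id t).mul_const (g x y)).exp).const_mul (W x y)).congr_deriv (by simp)

variable [Fintype X]

lemma contDiff_tilted_mulVec (W : Matrix X X ℝ) (g : X → X → ℝ) :
    ContDiff ℝ 2 fun p : ℝ × (X → ℝ) => tilted W g p.1 *ᵥ p.2 := by
  rw [contDiff_pi]
  intro x
  simp only [Matrix.mulVec, dotProduct, tilted, Matrix.of_apply]
  fun_prop

/-- The map `(θ, v) ↦ M v - (1ᵀ M v) v`, where `M` is the tilted matrix. A nonzero `v`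
where it vanishes is an eigenvector of `M` whose eigenvalue is the total mass of `M v`. -/
noncomputable def eigenDefect (W : Matrix X X ℝ) (g : X → X → ℝ) (p : ℝ × (X → ℝ)) : X → ℝ :=
  tilted W g p.1 *ᵥ p.2 - (∑ x, (tilted W g p.1 *ᵥ p.2) x) • p.2

lemma contDiff_eigenDefect (W : Matrix X X ℝ) (g : X → X → ℝ) :
    ContDiff ℝ 2 (eigenDefect W g) := by
  have h := contDiff_tilted_mulVec W g
  have h' := contDiff_pi.1 h
  refine h.sub (ContDiff.smul (ContDiff.sum fun x _ => h' x) contDiff_snd)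

lemma stationaryProjector_mulVec (P v : X → ℝ) :
    stationaryProjector P *ᵥ v = (∑ x, v x) • P := by
  ext x
  simp [stationaryProjector, Matrix.mulVec, dotProduct, ← Finset.mul_sum, mul_comm]

variable [DecidableEq X]

/-! ### Fixed vectors of an irreducible column-stochastic matrix -/

lemma sum_mulVec_of_colStochastic {W : Matrix X X ℝ} (hW : W ∈ Matrix.colStochastic ℝ X)
    (v : X → ℝ) : ∑ x, (W *ᵥ v) x = ∑ x, v x := by
  simp only [Matrix.mulVec, dotProduct]
  rw [Finset.sum_comm]
  simp [← Finset.sum_mul, Matrix.sum_col_of_mem_colStochastic hW]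

lemma pow_mulVec_of_fixed {W : Matrix X X ℝ} {v : X → ℝ} (h : W *ᵥ v = v) (n : ℕ) :
    (W ^ n) *ᵥ v = v := by
  induction n with
  | zero => simp
  | succ n ih => rw [pow_succ, ← Matrix.mulVec_mulVec, h, ih]

lemma pos_of_fixed {W : Matrix X X ℝ} (hirr : W.IsIrreducible) {v : X → ℝ} (h : W *ᵥ v = v)
    (h0 : ∀ x, 0 ≤ v x) {y : X} (hy : 0 < v y) (x : X) : 0 < v x := by
  obtain ⟨n, -, hn⟩ := (Matrix.isIrreducible_iff_exists_pow_pos hirr.nonneg).1 hirr x y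
  have hnn : ∀ i j, 0 ≤ (W ^ n) i j := Matrix.pow_apply_nonneg hirr.nonneg n
  rw [← pow_mulVec_of_fixed h n]
  exact Finset.sum_pos' (fun i _ => mul_nonneg (hnn x i) (h0 i))
    ⟨y, Finset.mem_univ _, mul_pos hn hy⟩

/-- The triangle inequality gives `|v| ≤ W |v|` entrywise, and both sides have the same total. -/
lemma abs_fixed {W : Matrix X X ℝ} (hW : W ∈ Matrix.colStochastic ℝ X) {v : X → ℝ}
    (h : W *ᵥ v = v) : W *ᵥ (fun x => |v x|) = fun x => |v x| := by
  have hle : ∀ x ∈ Finset.univ, |v x| ≤ (W *ᵥ fun x => |v x|) x := by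
    intro x _
    have hx : v x = ∑ y, W x y * v y := (congrFun h x).symm
    rw [hx]
    refine (Finset.abs_sum_le_sum_abs _ _).trans (le_of_eq ?_)
    simp only [Matrix.mulVec, dotProduct, abs_mul,
      abs_of_nonneg (Matrix.nonneg_of_mem_colStochastic hW)]
  have := (Finset.sum_eq_sum_iff_of_le hle).1 (sum_mulVec_of_colStochastic hW _).symm
  exact funext fun x => (this x (Finset.mem_univ x)).symm

/-- The fixed vectors `|v|` and `|v| + v` are nonnegative, hence zero or entrywise positive;
so `v` has constant strict sign or vanishes, and the zero total leaves only `v = 0`. -/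
lemma eq_zero_of_fixed {W : Matrix X X ℝ} (hW : W ∈ Matrix.colStochastic ℝ X)
    (hirr : W.IsIrreducible) {v : X → ℝ} (h : W *ᵥ v = v) (hs : ∑ x, v x = 0) : v = 0 := by
  have hplus : W *ᵥ ((fun x => |v x|) + v) = (fun x => |v x|) + v := by
    rw [Matrix.mulVec_add, abs_fixed hW h, h]
  have hnn : ∀ x, 0 ≤ ((fun x => |v x|) + v) x := fun x => by
    have := neg_abs_le (v x)
    simp only [Pi.add_apply]
    linarith
  have hnonpos : ∀ x ∈ Finset.univ, v x ≤ 0 := by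
    intro y _
    by_contra! hy
    have hpos := pos_of_fixed hirr hplus hnn (y := y) (by
      simp only [Pi.add_apply]; positivity)
    have hv : ∀ x, 0 < v x := fun x => by
      by_contra! hx
      have := hpos x
      simp [abs_of_nonpos hx] at this
    have : 0 < ∑ x, v x := Finset.sum_pos (fun x _ => hv x) ⟨y, Finset.mem_univ _⟩
    linarith
  exact funext fun x => (Finset.sum_eq_zero_iff_of_nonpos hnonpos).1 hs x (Finset.mem_univ x)

lemma IsStationaryDistribution.pos {W : Matrix X X ℝ} (hirr : W.IsIrreducible) {P : X → ℝ}
    (hP : IsStationaryDistribution W P) (x : X) : 0 < P x := by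
  obtain ⟨y, -, hy⟩ : ∃ y ∈ Finset.univ, P y ≠ 0 :=
    Finset.exists_ne_zero_of_sum_ne_zero (by rw [hP.sum_eq_one]; exact one_ne_zero)
  exact pos_of_fixed hirr hP.stationary hP.nonneg ((hP.nonneg y).lt_of_ne' hy) x

/-- Since `1ᵀ W = 1ᵀ`, the number `1` is an eigenvalue of `W`; the normalized absolute value of a
real eigenvector is a stationary distribution. -/
lemma exists_isStationaryDistribution [Nonempty X] {W : Matrix X X ℝ}
    (hW : W ∈ Matrix.colStochastic ℝ X) : ∃ P, IsStationaryDistribution W P := by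
  have hdet : (W - 1).det = 0 := by
    refine Matrix.exists_vecMul_eq_zero_iff.1 ⟨1, one_ne_zero, ?_⟩
    rw [Matrix.vecMul_sub, Matrix.one_vecMul_of_mem_colStochastic hW, Matrix.vecMul_one, sub_self]
  obtain ⟨v, hv0, hv⟩ := Matrix.exists_mulVec_eq_zero_iff.2 hdet
  have hfix : W *ᵥ v = v := by
    rwa [Matrix.sub_mulVec, Matrix.one_mulVec, sub_eq_zero] at hv
  obtain ⟨y, hy⟩ := Function.ne_iff.1 hv0
  have hs : 0 < ∑ x, |v x| :=
    Finset.sum_pos' (fun x _ => abs_nonneg _) ⟨y, Finset.mem_univ _, abs_pos.2 hy⟩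
  refine ⟨(∑ x, |v x|)⁻¹ • fun x => |v x|, fun x => ?_, ?_, ?_⟩
  · simp only [Pi.smul_apply, smul_eq_mul]
    positivity
  · simp only [Pi.smul_apply, smul_eq_mul, ← Finset.mul_sum]
    exact inv_mul_cancel₀ hs.ne'
  · rw [Matrix.mulVec_smul, abs_fixed hW hfix]

lemma IsStationaryDistribution.unique {W : Matrix X X ℝ} (hW : W ∈ Matrix.colStochastic ℝ X)
    (hirr : W.IsIrreducible) {P Q : X → ℝ} (hP : IsStationaryDistribution W P)
    (hQ : IsStationaryDistribution W Q) : P = Q := by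
  refine sub_eq_zero.1 (eq_zero_of_fixed hW hirr ?_ ?_)
  · rw [Matrix.mulVec_sub, hP.stationary, hQ.stationary]
  · simp [Finset.sum_sub_distrib, hP.sum_eq_one, hQ.sum_eq_one]

/-! ### The fundamental matrix -/

lemma one_sub_mulVec (W : Matrix X X ℝ) (P v : X → ℝ) :
    (1 - (W - stationaryProjector P)) *ᵥ v = v - W *ᵥ v + (∑ x, v x) • P := by
  rw [Matrix.sub_mulVec, Matrix.sub_mulVec, Matrix.one_mulVec, stationaryProjector_mulVec]
  abel

lemma isUnit_one_sub {W : Matrix X X ℝ} (hW : W ∈ Matrix.colStochastic ℝ X)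
    (hirr : W.IsIrreducible) {P : X → ℝ} (hP : IsStationaryDistribution W P) :
    IsUnit (1 - (W - stationaryProjector P)) := by
  rw [← Matrix.mulVec_injective_iff_isUnit]
  refine (injective_iff_map_eq_zero (Matrix.mulVecLin _)).2 fun v hv => ?_
  rw [Matrix.mulVecLin_apply, one_sub_mulVec] at hv
  have hs : ∑ x, v x = 0 := by
    have := congrArg (fun w : X → ℝ => ∑ x, w x) hv
    simpa [Finset.sum_add_distrib, Finset.sum_sub_distrib, sum_mulVec_of_colStochastic hW,
      ← Finset.mul_sum, hP.sum_eq_one] using this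
  rw [hs, zero_smul, add_zero, sub_eq_zero] at hv
  exact eq_zero_of_fixed hW hirr hv.symm hs

/-- The matrix `Z - A` is the reduced resolvent of `W` at the eigenvalue `1`: it inverts `I - W`
on vectors of total zero, after projecting away the stationary component. -/
lemma eq_fundamentalMatrix_sub_mulVec {W : Matrix X X ℝ} {P : X → ℝ}
    (hP : IsStationaryDistribution W P) (hN : IsUnit (1 - (W - stationaryProjector P)))
    {u b : X → ℝ} (hu : ∑ x, u x = 0) (h : u - W *ᵥ u = b - (∑ x, b x) • P) :
    u = (fundamentalMatrix W P - stationaryProjector P) *ᵥ b := by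
  have hinv : fundamentalMatrix W P * (1 - (W - stationaryProjector P)) = 1 :=
    Matrix.nonsing_inv_mul _ ((Matrix.isUnit_iff_isUnit_det _).1 hN)
  have hZ : ∀ v, fundamentalMatrix W P *ᵥ ((1 - (W - stationaryProjector P)) *ᵥ v) = v := by
    intro v
    rw [Matrix.mulVec_mulVec, hinv, Matrix.one_mulVec]
  have hZP : fundamentalMatrix W P *ᵥ P = P := by
    have := hZ P
    rwa [one_sub_mulVec, hP.stationary, hP.sum_eq_one, sub_self, zero_add, one_smul] at this
  have hZu := hZ u
  rw [one_sub_mulVec, hu, zero_smul, add_zero, h, Matrix.mulVec_sub, Matrix.mulVec_smul,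
    hZP] at hZu
  rw [Matrix.sub_mulVec, stationaryProjector_mulVec, hZu]

/-! ### The spectral radius of a nonnegative matrix with a positive eigenvector -/

/-- Compare an arbitrary complex eigenvector `w` with the positive eigenvector `v` at an index
where the ratio `|w x| / v x` is largest. -/
lemma norm_le_of_mem_spectrum {M : Matrix X X ℝ} (hM : ∀ x y, 0 ≤ M x y) {v : X → ℝ}
    (hv : ∀ x, 0 < v x) {l : ℝ} (h : M *ᵥ v = l • v) {μ : ℂ}
    (hμ : μ ∈ spectrum ℂ (M.map (fun r : ℝ => (r : ℂ)))) : ‖μ‖ ≤ l := by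
  rw [← Matrix.spectrum_toLin', ← Module.End.hasEigenvalue_iff_mem_spectrum] at hμ
  obtain ⟨w, hw⟩ := hμ.exists_hasEigenvector
  have hw1 : ∀ x, ∑ y, (M x y : ℂ) * w y = μ * w x := fun x => by
    have := congrFun hw.apply_eq_smul x
    simpa [Matrix.mulVec, dotProduct] using this
  obtain ⟨x₀, hx₀⟩ := Function.ne_iff.1 hw.2
  have hne : Nonempty X := ⟨x₀⟩
  obtain ⟨x, hx⟩ := Finite.exists_max fun x => ‖w x‖ / v x
  have hc : 0 < ‖w x‖ / v x := lt_of_lt_of_le (div_pos (norm_pos_iff.2 hx₀) (hv x₀)) (hx x₀)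
  have hbound : ∀ y, ‖w y‖ ≤ ‖w x‖ / v x * v y := fun y => (div_le_iff₀ (hv y)).1 (hx y)
  have hvx : ∑ y, M x y * v y = l * v x := congrFun h x
  have key : ‖μ‖ * ‖w x‖ ≤ l * ‖w x‖ := by
    calc ‖μ‖ * ‖w x‖ = ‖∑ y, (M x y : ℂ) * w y‖ := by rw [hw1, norm_mul]
      _ ≤ ∑ y, M x y * ‖w y‖ := by
        refine (norm_sum_le _ _).trans (le_of_eq ?_)
        simp [abs_of_nonneg (hM x _)]
      _ ≤ ∑ y, M x y * (‖w x‖ / v x * v y) :=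
        Finset.sum_le_sum fun y _ => mul_le_mul_of_nonneg_left (hbound y) (hM x y)
      _ = ‖w x‖ / v x * ∑ y, M x y * v y := by
        rw [Finset.mul_sum]
        exact Finset.sum_congr rfl fun y _ => by ring
      _ = l * ‖w x‖ := by
        rw [hvx]
        field_simp [(hv x).ne']
  have hwx : 0 < ‖w x‖ := by
    have := mul_pos hc (hv x)
    rwa [div_mul_cancel₀ _ (hv x).ne'] at this
  exact le_of_mul_le_mul_right key hwx

lemma perronFrobeniusEigenvalue_eq [Nonempty X] {M : Matrix X X ℝ} (hM : ∀ x y, 0 ≤ M x y)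
    {v : X → ℝ} (hv : ∀ x, 0 < v x) {l : ℝ} (h : M *ᵥ v = l • v) :
    perronFrobeniusEigenvalue M = l := by
  obtain ⟨x₀⟩ := ‹Nonempty X›
  have hmem : (l : ℂ) ∈ spectrum ℂ (M.map (fun r : ℝ => (r : ℂ))) := by
    rw [← Matrix.spectrum_toLin', ← Module.End.hasEigenvalue_iff_mem_spectrum]
    refine Module.End.hasEigenvalue_of_hasEigenvector (x := fun x => (v x : ℂ)) ⟨?_, ?_⟩
    · rw [Module.End.mem_eigenspace_iff]
      ext x
      have : ∑ y, M x y * v y = l * v x := congrFun h x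
      simp only [Matrix.toLin'_apply, Matrix.mulVec, dotProduct, Matrix.map_apply, Pi.smul_apply,
        smul_eq_mul]
      exact_mod_cast this
    · intro h0
      have := congrFun h0 x₀
      simp [(hv x₀).ne'] at this
  have hl : 0 ≤ l := (norm_nonneg _).trans (norm_le_of_mem_spectrum hM hv h hmem)
  have : spectralRadius ℂ (M.map (fun r : ℝ => (r : ℂ))) = ENNReal.ofReal l := by
    refine le_antisymm (iSup₂_le fun μ hμ => ?_) ?_
    · rw [← enorm_eq_nnnorm, ← ofReal_norm]
      exact ENNReal.ofReal_le_ofReal (norm_le_of_mem_spectrum hM hv h hμ)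
    · refine le_trans (le_of_eq ?_) (le_iSup₂ (l : ℂ) hmem)
      rw [← enorm_eq_nnnorm, ← ofReal_norm, Complex.norm_real, Real.norm_of_nonneg hl]
  rw [perronFrobeniusEigenvalue, this, ENNReal.toReal_ofReal hl]

/-! ### A smooth branch of Perron-Frobenius eigenvectors -/

/-- At `(0, P)` the partial derivative of the eigenvector equation in `v` is
`-(I - (W - A))`. -/
lemma fderiv_eigenDefect_inr {W : Matrix X X ℝ} (hW : W ∈ Matrix.colStochastic ℝ X)
    (g : X → X → ℝ) {P : X → ℝ} (hP : IsStationaryDistribution W P) (u : X → ℝ) :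
    (fderiv ℝ (eigenDefect W g) (0, P) ∘L .inr ℝ ℝ (X → ℝ)) u =
      -((1 - (W - stationaryProjector P)) *ᵥ u) := by
  have hF : HasFDerivAt (eigenDefect W g) (fderiv ℝ (eigenDefect W g) (0, P)) (0, P) :=
    ((contDiff_eigenDefect W g).differentiable (by norm_num) _).hasFDerivAt
  -- The partial derivative is computed along the line `t ↦ (0, P + t • u)`.
  have hline : HasDerivAt (fun t : ℝ => ((0 : ℝ), P + t • u)) ((0 : ℝ), u) 0 := by
    refine (hasDerivAt_const _ _).prodMk ?_
    simpa using ((hasDerivAt_id (0 : ℝ)).smul_const u).const_add P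
  have h1 := hF.comp_hasDerivAt_of_eq (0 : ℝ) hline (by simp)
  have heq : (eigenDefect W g ∘ fun t : ℝ => ((0 : ℝ), P + t • u)) =
      fun t : ℝ => P + t • (W *ᵥ u) - (1 + t * ∑ x, u x) • (P + t • u) := by
    ext t : 1
    simp only [Function.comp_apply, eigenDefect, tilted_zero, sum_mulVec_of_colStochastic hW]
    rw [Matrix.mulVec_add, Matrix.mulVec_smul, hP.stationary]
    simp only [Pi.add_apply, Pi.smul_apply, smul_eq_mul, Finset.sum_add_distrib, hP.sum_eq_one,
      ← Finset.mul_sum]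
  rw [heq] at h1
  have hid := hasDerivAt_id (0 : ℝ)
  have h2 := (((hid.smul_const (W *ᵥ u)).const_add P)).sub
    (((hid.mul_const (∑ x, u x)).const_add 1).smul ((hid.smul_const u).const_add P))
  have := h1.unique h2
  rw [ContinuousLinearMap.comp_apply, ContinuousLinearMap.inr_apply, this, one_sub_mulVec]
  simp
  abel

/-- The implicit function theorem applied to the eigenvector equation. Summing the equation
`M v = (1ᵀ M v) v` gives `1ᵀ v = 1`, since `1ᵀ M v` is close to `1`. -/
lemma exists_eigenvector_branch {W : Matrix X X ℝ} (hW : W ∈ Matrix.colStochastic ℝ X)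
    (hirr : W.IsIrreducible) (g : X → X → ℝ) {P : X → ℝ} (hP : IsStationaryDistribution W P) :
    ∃ v : ℝ → X → ℝ, ContDiffAt ℝ 2 v 0 ∧ v 0 = P ∧
      (∀ᶠ t in 𝓝 0, tilted W g t *ᵥ v t = (∑ x, (tilted W g t *ᵥ v t) x) • v t) ∧
      (∀ᶠ t in 𝓝 0, ∑ x, v t x = 1) ∧
      (∀ᶠ t in 𝓝 0, ∀ x, 0 < v t x) ∧
      ContDiffAt ℝ 2 (fun t => ∑ x, (tilted W g t *ᵥ v t) x) 0 := by
  have hcd : ContDiffAt ℝ 2 (eigenDefect W g) (0, P) := (contDiff_eigenDefect W g).contDiffAt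
  have hinj : Function.Injective
      (fderiv ℝ (eigenDefect W g) (0, P) ∘L .inr ℝ ℝ (X → ℝ)) := by
    intro u w huw
    rw [fderiv_eigenDefect_inr hW g hP, fderiv_eigenDefect_inr hW g hP, neg_inj] at huw
    exact Matrix.mulVec_injective_iff_isUnit.2 (isUnit_one_sub hW hirr hP) huw
  have hinv : (fderiv ℝ (eigenDefect W g) (0, P) ∘L .inr ℝ ℝ (X → ℝ)).IsInvertible :=
    ⟨(LinearEquiv.ofInjectiveEndo _ hinj).toContinuousLinearEquiv, by ext; rfl⟩
  set v := hcd.implicitFunction two_ne_zero hinv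
  have hv2 : ContDiffAt ℝ 2 v 0 := hcd.contDiffAt_implicitFunction two_ne_zero hinv
  have hv0 : v 0 = P := hcd.implicitFunction_apply_self two_ne_zero hinv
  have hl2 : ContDiffAt ℝ 2 (fun t => ∑ x, (tilted W g t *ᵥ v t) x) 0 := by
    have := (contDiff_tilted_mulVec W g).contDiffAt.comp (0 : ℝ) (contDiffAt_id.prodMk hv2)
    exact ContDiffAt.sum fun x _ => contDiffAt_pi.1 this x
  have hbase : eigenDefect W g (0, P) = 0 := by
    simp [eigenDefect, hP.stationary, hP.sum_eq_one]
  have heig : ∀ᶠ t in 𝓝 0,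
      tilted W g t *ᵥ v t = (∑ x, (tilted W g t *ᵥ v t) x) • v t := by
    filter_upwards [hcd.eventually_apply_implicitFunction two_ne_zero hinv] with t ht
    rw [hbase] at ht
    exact sub_eq_zero.1 ht
  have hlne : ∀ᶠ t in 𝓝 0, ∑ x, (tilted W g t *ᵥ v t) x ≠ 0 := by
    refine hl2.continuousAt.eventually_ne ?_
    simp [hv0, hP.stationary, hP.sum_eq_one]
  refine ⟨v, hv2, hv0, heig, ?_, ?_, hl2⟩
  · filter_upwards [heig, hlne] with t h1 h2
    have := congrArg (fun w : X → ℝ => ∑ x, w x) h1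
    simp only [Pi.smul_apply, smul_eq_mul, ← Finset.mul_sum] at this
    exact (mul_eq_left₀ h2).1 this.symm
  · refine Filter.eventually_all.2 fun x => ?_
    have hc : ContinuousAt (fun t => v t x) 0 := (contDiffAt_pi.1 hv2 x).continuousAt
    exact hc.eventually (lt_mem_nhds (by simpa only [hv0] using hP.pos hirr x))

/-! ### Differentiation of the eigenvalue -/

lemma hasDerivAt_deriv_of_contDiffAt_two {E : Type*} [NormedAddCommGroup E] [NormedSpace ℝ E]
    {f : ℝ → E} {a : ℝ} (hf : ContDiffAt ℝ 2 f a) :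
    (∀ᶠ t in 𝓝 a, HasDerivAt f (deriv f t) t) ∧
      HasDerivAt (deriv f) (deriv (deriv f) a) a := by
  refine ⟨?_, ?_⟩
  · filter_upwards [hf.eventually (by simp)] with t ht
    exact (ht.differentiableAt (by norm_num)).hasDerivAt
  · have h1 : ContDiffAt ℝ 1 (deriv f) a := hf.derivWithin (by norm_num)
    exact (h1.differentiableAt one_ne_zero).hasDerivAt

/-- The first two derivatives at `0` of the eigenvalue branch `1ᵀ M v`. -/
lemma deriv_eigenvalue_branch {W : Matrix X X ℝ} (hW : W ∈ Matrix.colStochastic ℝ X)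
    (g : X → X → ℝ) {P : X → ℝ} (hP : IsStationaryDistribution W P)
    (hN : IsUnit (1 - (W - stationaryProjector P)))
    {v : ℝ → X → ℝ} (hv2 : ContDiffAt ℝ 2 v 0) (hv0 : v 0 = P)
    (heig : ∀ᶠ t in 𝓝 0, tilted W g t *ᵥ v t = (∑ x, (tilted W g t *ᵥ v t) x) • v t)
    (hsum : ∀ᶠ t in 𝓝 0, ∑ x, v t x = 1) :
    deriv (fun t => ∑ x, (tilted W g t *ᵥ v t) x) 0 = jointExpectation W P g ∧
    deriv (deriv fun t => ∑ x, (tilted W g t *ᵥ v t) x) 0 =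
      jointExpectation W P (fun x y => g x y ^ 2) +
        2 * ∑ x, ∑ y, (∑ x', g x' x * W x' x) *
          (fundamentalMatrix W P - stationaryProjector P) x y *
            (∑ y', g y y' * P y' * W y y') := by
  obtain ⟨hv', hv''⟩ := hasDerivAt_deriv_of_contDiffAt_two hv2
  set u := deriv v 0
  set w := deriv (deriv v) 0
  have hsum' : ∀ᶠ t in 𝓝 0, ∑ x, deriv v t x = 0 := by
    filter_upwards [hsum.eventually_nhds, hv'] with t h1 h2
    have h3 : HasDerivAt (fun t => ∑ x, v t x) (∑ x, deriv v t x) t :=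
      HasDerivAt.fun_sum fun x _ => hasDerivAt_pi.1 h2 x
    exact h3.unique ((hasDerivAt_const t (1 : ℝ)).congr_of_eventuallyEq h1)
  have hu0 : ∑ x, u x = 0 := hsum'.self_of_nhds
  have hw0 : ∑ x, w x = 0 := by
    have h3 : HasDerivAt (fun t => ∑ x, deriv v t x) (∑ x, w x) 0 :=
      HasDerivAt.fun_sum fun x _ => hasDerivAt_pi.1 hv'' x
    exact h3.unique ((hasDerivAt_const (0 : ℝ) (0 : ℝ)).congr_of_eventuallyEq hsum')
  have hMv : ∀ᶠ t in 𝓝 0, ∀ x, HasDerivAt (fun t => (tilted W g t *ᵥ v t) x)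
      (∑ y, (tilted W g t x y * g x y * v t y + tilted W g t x y * deriv v t y)) t := by
    filter_upwards [hv'] with t h2 x
    simp only [Matrix.mulVec, dotProduct]
    exact HasDerivAt.fun_sum fun y _ =>
      (hasDerivAt_tilted_apply W g x y t).mul (hasDerivAt_pi.1 h2 y)
  have hl' : ∀ᶠ t in 𝓝 0, HasDerivAt (fun t => ∑ x, (tilted W g t *ᵥ v t) x)
      (∑ x, ∑ y, (tilted W g t x y * g x y * v t y + tilted W g t x y * deriv v t y)) t := by
    filter_upwards [hMv] with t h
    exact HasDerivAt.fun_sum fun x _ => h x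
  have hl'' : HasDerivAt (fun t => ∑ x, ∑ y,
        (tilted W g t x y * g x y * v t y + tilted W g t x y * deriv v t y))
      (∑ x, ∑ y, (W x y * g x y * g x y * P y + W x y * g x y * u y +
        (W x y * g x y * u y + W x y * w y))) 0 := by
    refine HasDerivAt.fun_sum fun x _ => HasDerivAt.fun_sum fun y _ => ?_
    have ht := hasDerivAt_tilted_apply W g x y 0
    have h := ((ht.mul_const (g x y)).mul (hasDerivAt_pi.1 hv'.self_of_nhds y)).add
      (ht.mul (hasDerivAt_pi.1 hv'' y))
    simp only [tilted_zero, hv0] at h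
    exact h
  have hWsum : ∀ z : X → ℝ, ∑ x, ∑ y, W x y * z y = ∑ x, z x :=
    sum_mulVec_of_colStochastic hW
  -- The vector `B P`, where `B` has entries `W x y * g x y`.
  set b : X → ℝ := fun y => ∑ y', g y y' * P y' * W y y'
  have hbsum : ∑ x, b x = jointExpectation W P g :=
    Finset.sum_congr rfl fun x _ => Finset.sum_congr rfl fun y _ => by ring
  have hd1 : HasDerivAt (fun t => ∑ x, (tilted W g t *ᵥ v t) x) (∑ x, b x) 0 := by
    convert hl'.self_of_nhds using 1
    simp only [tilted_zero, hv0, Finset.sum_add_distrib]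
    rw [hWsum, hu0, add_zero]
    exact Finset.sum_congr rfl fun x _ => Finset.sum_congr rfl fun y _ => by ring
  have hl0 : ∑ x, (tilted W g 0 *ᵥ v 0) x = 1 := by
    rw [tilted_zero, hv0, hP.stationary, hP.sum_eq_one]
  -- The derivative at `0` of the eigenvector equation `M v = l v`, with `l 0 = 1`.
  have hueq : u - W *ᵥ u = b - (∑ x, b x) • P := by
    ext x
    have h1 := hMv.self_of_nhds x
    have h2 : HasDerivAt (fun t => (tilted W g t *ᵥ v t) x) _ 0 :=
      (hd1.mul (hasDerivAt_pi.1 hv'.self_of_nhds x)).congr_of_eventuallyEq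
        (heig.mono fun t ht => congrFun ht x)
    have h3 := h1.unique h2
    rw [hl0] at h3
    simp only [tilted_zero, hv0, Finset.sum_add_distrib] at h3
    have h4 : ∑ y, W x y * g x y * P y = b x := Finset.sum_congr rfl fun y _ => by ring
    have h5 : (W *ᵥ u) x = ∑ y, W x y * u y := rfl
    simp only [Pi.sub_apply, Pi.smul_apply, smul_eq_mul]
    rw [h4] at h3
    rw [h5]
    linarith
  have huZ := eq_fundamentalMatrix_sub_mulVec hP hN hu0 hueq
  refine ⟨hd1.deriv.trans hbsum, ?_⟩
  have hderiv : deriv (fun t => ∑ x, (tilted W g t *ᵥ v t) x) =ᶠ[𝓝 0] fun t =>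
      ∑ x, ∑ y, (tilted W g t x y * g x y * v t y + tilted W g t x y * deriv v t y) :=
    hl'.mono fun t h => h.deriv
  rw [hderiv.deriv_eq, hl''.deriv]
  have hcross : ∑ x, ∑ y, W x y * g x y * u y =
      ∑ x, ∑ y, (∑ x', g x' x * W x' x) *
        (fundamentalMatrix W P - stationaryProjector P) x y * b y := by
    rw [Finset.sum_comm]
    refine Finset.sum_congr rfl fun x _ => ?_
    have hux : u x = ∑ y, (fundamentalMatrix W P - stationaryProjector P) x y * b y :=
      congrFun huZ x
    simp only [mul_assoc, ← Finset.mul_sum]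
    rw [← hux, Finset.sum_mul]
    exact Finset.sum_congr rfl fun x' _ => by ring
  have hsq : ∑ x, ∑ y, W x y * g x y * g x y * P y =
      jointExpectation W P (fun x y => g x y ^ 2) :=
    Finset.sum_congr rfl fun x _ => Finset.sum_congr rfl fun y _ => by ring
  simp only [Finset.sum_add_distrib]
  rw [hWsum, hw0, hcross, hsq]
  ring

/-! ### The potential function -/

lemma jointVariance_eq {W : Matrix X X ℝ} (hW : W ∈ Matrix.colStochastic ℝ X)
    {P : X → ℝ} (hP : IsStationaryDistribution W P) (g : X → X → ℝ) :
    jointVariance W P g =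
      jointExpectation W P (fun x y => g x y ^ 2) - jointExpectation W P g ^ 2 := by
  have hmass : ∑ x, ∑ y, W x y * P y = 1 :=
    (sum_mulVec_of_colStochastic hW P).trans hP.sum_eq_one
  have hE : jointExpectation W P g = ∑ x, ∑ y, W x y * P y * g x y := rfl
  rw [jointVariance]
  generalize jointExpectation W P g = m at *
  have : jointExpectation W P (fun x y => (g x y - m) ^ 2) =
      jointExpectation W P (fun x y => g x y ^ 2) -
        2 * m * ∑ x, ∑ y, W x y * P y * g x y + m ^ 2 * ∑ x, ∑ y, W x y * P y := by
    simp only [jointExpectation, Finset.mul_sum, ← Finset.sum_sub_distrib,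
      ← Finset.sum_add_distrib]
    exact Finset.sum_congr rfl fun x _ => Finset.sum_congr rfl fun y _ => by ring
  rw [this, hmass, ← hE]
  ring

/-- At a point where `l = 1`, the second derivative of `log l` is `l'' - l' ^ 2`. -/
lemma deriv_deriv_log_of_eq_one {l : ℝ → ℝ} {a : ℝ} (hl : ContDiffAt ℝ 2 l a) (h1 : l a = 1) :
    deriv (deriv fun t => Real.log (l t)) a = deriv (deriv l) a - deriv l a ^ 2 := by
  obtain ⟨hl', hl''⟩ := hasDerivAt_deriv_of_contDiffAt_two hl
  have hne : ∀ᶠ t in 𝓝 a, l t ≠ 0 := hl.continuousAt.eventually_ne (by simp [h1])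
  have heq : deriv (fun t => Real.log (l t)) =ᶠ[𝓝 a] fun t => deriv l t / l t := by
    filter_upwards [hl', hne] with t h2 h3
    exact (h2.log h3).deriv
  have hq : HasDerivAt (fun t => deriv l t / l t) _ a :=
    hl''.div hl'.self_of_nhds hne.self_of_nhds
  rw [heq.deriv_eq, hq.deriv, h1]
  ring

end MarkovAsymptoticVariance

open MarkovAsymptoticVariance in
theorem mainTheorem9 {X : Type*} [Fintype X] [DecidableEq X] [Nonempty X]
    (W : Matrix X X ℝ) (hW : MarkovAsymptoticVariance.IsErgodicTransition W)
    (g : X → X → ℝ) :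
    (∃! P : X → ℝ, MarkovAsymptoticVariance.IsStationaryDistribution W P) ∧
    ContDiffAt ℝ 2 (MarkovAsymptoticVariance.potential W g) 0 ∧
    ∀ P : X → ℝ, MarkovAsymptoticVariance.IsStationaryDistribution W P →
      IsUnit (1 - (W - MarkovAsymptoticVariance.stationaryProjector P)) ∧
      deriv (deriv (MarkovAsymptoticVariance.potential W g)) 0 =
        MarkovAsymptoticVariance.jointVariance W P g +
          2 * ∑ x, ∑ y,
            (∑ x', g x' x * W x' x) *
              (MarkovAsymptoticVariance.fundamentalMatrix W P -
                MarkovAsymptoticVariance.stationaryProjector P) x y *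
              (∑ y', g y y' * P y' * W y y') := by
  have hst := hW.stochastic
  have hirr := hW.irreducible
  obtain ⟨P, hP⟩ := exists_isStationaryDistribution hst
  obtain ⟨v, hv2, hv0, heig, hsum, hpos, hl2⟩ := exists_eigenvector_branch hst hirr g hP
  have hpot : potential W g =ᶠ[𝓝 0] fun t => Real.log (∑ x, (tilted W g t *ᵥ v t) x) := by
    filter_upwards [heig, hpos] with t h1 h2
    have hnn : ∀ x y, 0 ≤ tilted W g t x y := fun x y =>
      mul_nonneg (Matrix.nonneg_of_mem_colStochastic hst) (Real.exp_pos _).le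
    rw [potential, perronFrobeniusEigenvalue_eq hnn h2 h1]
  have hl0 : ∑ x, (tilted W g 0 *ᵥ v 0) x = 1 := by
    rw [tilted_zero, hv0, hP.stationary, hP.sum_eq_one]
  refine ⟨⟨P, hP, fun Q hQ => hQ.unique hst hirr hP⟩, ?_, fun Q hQ => ?_⟩
  · exact (hl2.log (by rw [hl0]; exact one_ne_zero)).congr_of_eventuallyEq hpot
  · obtain rfl := hP.unique hst hirr hQ
    have hN := isUnit_one_sub hst hirr hP
    refine ⟨hN, ?_⟩
    obtain ⟨h1, h2⟩ := deriv_eigenvalue_branch hst g hP hN hv2 hv0 heig hsum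
    rw [hpot.deriv.deriv_eq, deriv_deriv_log_of_eq_one hl2 hl0, h1, h2,
      jointVariance_eq hst hP]
    ring
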